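/- Let $\mathbb{F}$ be a field, $n\in\mathbb{N}$, and let $\xi$ be a point process on $\mathbb{R}^n$ over a probability space $(\Omega,\mathcal{E},\mathbb{P})$, i.e. a measurable map from $\Omega$ into the boundedly finite integer-valued Borel measures on $\mathbb{R}^n$. Assume that $\xi$ is - simple: a.s. all atoms of $\xi$ have mass one; - stationary: for every $x\in\mathbb{R}^n$ the random measures $\xi$ and $\theta_x\xi$, $(\theta_x\xi)(A):=\xi(A+x)$, have the same distribution; - ergodic: $\mathbb{P}(\xi\in\mathcal{A})\in\{0,1\}$ for every measurable set $\mathcal{A}$ of measures that is invariant under all translations $\theta_x$; - of finite moments of all orders: $\mathbb{E}[\xi(A)^k]<\infty$ for all $k\ge 1$ and all bounded Borel sets $A\subset\mathbb{R}^n$. For a bounded Borel set $A\subset\mathbb{R}^n$ let $X_{\xi_\omega}(A)$ be the (finite) set of atoms of $\xi_\omega$ in $A$. For $0\le\ell\le n-1$ let $\mathrm{Dgm}_\ell(X_{\xi_\omega}(A))$ be the $\ell$-th persistence diagram, with coefficients in $\mathbb{F}$, of its filtration of Čech complexes $\check C_r(X)=\{\emptyset\neq\sigma\subseteq X : \bigcap_{x\in\sigma}B_r(x)\ne\emptyset\}$,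 $r\ge 0$, where $B_r(x)$ is the closed ball; it is the multiset of pairs $(b,d)$ of finite birth and death radii in $\Delta:=\{(b,d)\in\mathbb{R}^2 : b<d\}$ (classes that never die are not recorded). Let $$\rho_\omega(A):=\sum_{\ell=0}^{n-1}\ \sum_{x\in \mathrm{Dgm}_\ell(X_{\xi_\omega}(A))}\delta_x ,$$ the points being counted with multiplicity, be the persistence diagram measure. Then the persistence diagram expectation measure of $\xi$ exists. That is, for every bounded Borel set $A\subset\mathbb{R}^n$, the map $\omega\mapsto\rho_\omega(A)$ is a point process on $\Delta$, and there is a Radon measure $\mathfrak{p}(A)$ on $\Delta$ with $$\mathfrak{p}(A)(B)=\mathbb{E}[\rho(A)(B)]\qquad\text{for all Borel sets } B\subseteq\Delta .$$ Moreover, $\mathfrak{p}(A)(B)<\infty$ for every bounded Borel set $B\subseteq\Delta$. -/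

import Mathlib

open MeasureTheory Filter Topology Bornology
open scoped ENNReal

noncomputable section

/-! ### Point processes -/

/-- A point process on a metric space `S`, as a measurable map into the boundedly finite,
integer-valued Borel measures on `S`. The σ-algebra on `Measure S` is the one generated by the
evaluations `μ ↦ μ B`, whose trace on the boundedly finite measures is the Borel σ-algebra of that
space. -/
structure IsPointProcess {Ω S : Type*} [MeasurableSpace Ω] [PseudoMetricSpace S]
    [MeasurableSpace S] (ξ : Ω → Measure S) : Prop where
  measurable : Measurable ξ
  exists_nat : ∀ ω (A : Set S), MeasurableSet A → IsBounded A → ∃ k : ℕ, ξ ω A = k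

/-- Almost surely all atoms are distinct, i.e. no atom has multiplicity larger than one. -/
def IsSimplePointProcess {Ω S : Type*} [MeasurableSpace Ω] [MeasurableSpace S]
    (P : Measure Ω) (ξ : Ω → Measure S) : Prop :=
  ∀ᵐ ω ∂P, ∀ x, ξ ω {x} ≤ 1

/-- `𝔼[ξ(A)^k] < ∞` for all `k ≥ 1` and all bounded Borel sets `A`. -/
def HasAllFiniteMoments {Ω S : Type*} [MeasurableSpace Ω] [PseudoMetricSpace S]
    [MeasurableSpace S] (P : Measure Ω) (ξ : Ω → Measure S) : Prop :=
  ∀ k : ℕ, 1 ≤ k → ∀ A : Set S, MeasurableSet A → IsBounded A → ∫⁻ ω, ξ ω A ^ k ∂P < ∞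

/-- The shifted measure `θ_x μ`, given by `(θ_x μ)(A) = μ(A + x)`. -/
def shiftMeasure {n : ℕ} (x : EuclideanSpace ℝ (Fin n))
    (μ : Measure (EuclideanSpace ℝ (Fin n))) : Measure (EuclideanSpace ℝ (Fin n)) :=
  μ.map (fun y => y - x)

/-- For all `x`, the random measures `ξ` and `θ_x ξ` have the same distribution. -/
def IsStationaryMeasure {Ω : Type*} [MeasurableSpace Ω] (P : Measure Ω) {n : ℕ}
    (ξ : Ω → Measure (EuclideanSpace ℝ (Fin n))) : Prop :=
  ∀ x, P.map (fun ω => shiftMeasure x (ξ ω)) = P.map ξ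

/-- Every translation invariant measurable set of measures has probability zero or one. -/
def IsErgodicMeasure {Ω : Type*} [MeasurableSpace Ω] (P : Measure Ω) {n : ℕ}
    (ξ : Ω → Measure (EuclideanSpace ℝ (Fin n))) : Prop :=
  ∀ 𝒜 : Set (Measure (EuclideanSpace ℝ (Fin n))), MeasurableSet 𝒜 →
    (∀ x, shiftMeasure x ⁻¹' 𝒜 = 𝒜) → P (ξ ⁻¹' 𝒜) = 0 ∨ P (ξ ⁻¹' 𝒜) = 1

/-- The set of atoms of `μ` in `A`. -/
def atomsIn {S : Type*} [MeasurableSpace S] (μ : Measure S) (A : Set S) : Set S :=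
  {x | x ∈ A ∧ μ {x} ≠ 0}

/-! ### Simplicial homology -/

section Homology

/-- The subquotient `Z / (Z ∩ B)` of a module; in the application below, `B ⊆ Z`. -/
abbrev Subquotient {R M : Type*} [Ring R] [AddCommGroup M] [Module R M] (Z B : Submodule R M) :
    Type _ :=
  Z ⧸ B.submoduleOf Z

/-- The map `Z / (Z ∩ B) → Z' / (Z' ∩ B')` induced by inclusions `Z ⊆ Z'` and `B ⊆ B'`. -/
def Subquotient.map {R M : Type*} [Ring R] [AddCommGroup M] [Module R M]
    {Z B Z' B' : Submodule R M} (hZ : Z ≤ Z') (hB : B ≤ B') :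
    Subquotient Z B →ₗ[R] Subquotient Z' B' :=
  Submodule.mapQ _ _ (Submodule.inclusion hZ) fun _ hx => hB hx

variable (F : Type*) [Field F] {V : Type*}

/-- The ordered `ℓ`-simplices of a complex: all tuples `(v₀, …, v_ℓ)` of vertices, repetitions
allowed, whose underlying set of vertices is a simplex. -/
def orderedSimplices (K : PreAbstractSimplicialComplex V) (ℓ : ℕ) : Set (Fin (ℓ + 1) → V) :=
  {v | ∃ σ ∈ K, (σ : Set V) = Set.range v}

/-- The boundary `∂(v₀, …, v_{ℓ+1}) = ∑ᵢ (-1)ⁱ (v₀, …, v̂ᵢ, …, v_{ℓ+1})` on formal linear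
combinations of tuples. -/
def boundaryMap (V : Type*) (ℓ : ℕ) :
    ((Fin (ℓ + 2) → V) →₀ F) →ₗ[F] ((Fin (ℓ + 1) → V) →₀ F) :=
  ∑ i : Fin (ℓ + 2), (-1 : F) ^ (i : ℕ) • Finsupp.lmapDomain F F (fun v => v ∘ i.succAbove)

/-- The `ℓ`-th chain group of the ordered simplicial chain complex (which computes the simplicial
homology of `K`), as a subspace of the space of all formal combinations of tuples. -/
def chains (K : PreAbstractSimplicialComplex V) (ℓ : ℕ) :
    Submodule F ((Fin (ℓ + 1) → V) →₀ F) :=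
  Finsupp.supported F F (orderedSimplices K ℓ)

/-- The `ℓ`-cycles; every `0`-chain is a cycle (homology is not reduced). -/
def cycles (K : PreAbstractSimplicialComplex V) :
    (ℓ : ℕ) → Submodule F ((Fin (ℓ + 1) → V) →₀ F)
  | 0 => chains F K 0
  | ℓ + 1 => chains F K (ℓ + 1) ⊓ LinearMap.ker (boundaryMap F V ℓ)

/-- The `ℓ`-boundaries. -/
def boundaries (K : PreAbstractSimplicialComplex V) (ℓ : ℕ) :
    Submodule F ((Fin (ℓ + 1) → V) →₀ F) :=
  (chains F K (ℓ + 1)).map (boundaryMap F V ℓ)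

/-- The `ℓ`-th simplicial homology group `H_ℓ(K)` with coefficients in `F`. -/
abbrev simplicialHomology (K : PreAbstractSimplicialComplex V) (ℓ : ℕ) : Type _ :=
  Subquotient (cycles F K ℓ) (boundaries F K ℓ)

variable {K L : PreAbstractSimplicialComplex V}

theorem chains_mono (h : K ≤ L) (ℓ : ℕ) : chains F K ℓ ≤ chains F L ℓ :=
  Finsupp.supported_mono fun _ ⟨σ, hσ, hv⟩ => ⟨σ, h hσ, hv⟩

theorem cycles_mono (h : K ≤ L) : ∀ ℓ : ℕ, cycles F K ℓ ≤ cycles F L ℓ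
  | 0 => chains_mono F h 0
  | ℓ + 1 => inf_le_inf_right _ (chains_mono F h (ℓ + 1))

theorem boundaries_mono (h : K ≤ L) (ℓ : ℕ) : boundaries F K ℓ ≤ boundaries F L ℓ :=
  Submodule.map_mono (chains_mono F h (ℓ + 1))

/-- The map `H_ℓ(K) → H_ℓ(L)` induced by an inclusion of complexes. -/
def simplicialHomologyMap (h : K ≤ L) (ℓ : ℕ) :
    simplicialHomology F K ℓ →ₗ[F] simplicialHomology F L ℓ :=
  Subquotient.map (cycles_mono F h ℓ) (boundaries_mono F h ℓ)

end Homology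

/-! ### Čech complexes and persistence diagrams -/

/-- The Čech complex of radius `r`: the nonempty finite `σ ⊆ X` for which the closed balls of radius
`r` around the points of `σ` have a common point. It has no simplices if `r < 0`. -/
def cechComplex {E : Type*} [PseudoMetricSpace E] (X : Set E) (r : ℝ) :
    PreAbstractSimplicialComplex E where
  faces := {σ | σ.Nonempty ∧ (σ : Set E) ⊆ X ∧ (⋂ x ∈ σ, Metric.closedBall x r).Nonempty}
  isRelLowerSet_faces := fun _ ⟨hne, hX, y, hy⟩ => ⟨hne, fun τ hτ hτne =>
    ⟨hτne, fun _ hx => hX (hτ hx), y, by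
      simp only [Set.mem_iInter] at hy ⊢
      exact fun x hx => hy x (hτ hx)⟩⟩

theorem cechComplex_mono {E : Type*} [PseudoMetricSpace E] (X : Set E) {r s : ℝ} (h : r ≤ s) :
    cechComplex X r ≤ cechComplex X s := by
  rintro σ ⟨hne, hX, y, hy⟩
  refine ⟨hne, hX, y, ?_⟩
  simp only [Set.mem_iInter] at hy ⊢
  exact fun x hx => Metric.closedBall_subset_closedBall h (hy x hx)

/-- The persistent Betti number `β_ℓ^{r,s} = rank (H_ℓ(Č_r(X)) → H_ℓ(Č_s(X)))` for `r ≤ s`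
(with the value `0`, which is never used, if `s < r`). -/
def persistentBetti (F : Type*) [Field F] {E : Type*} [PseudoMetricSpace E] (X : Set E) (ℓ : ℕ)
    (r s : ℝ) : ℕ :=
  open Classical in
  if h : r ≤ s then
    Module.finrank F (LinearMap.range (simplicialHomologyMap F (cechComplex_mono X h) ℓ))
  else 0

/-- The open half plane `Δ = {(b, d) ∈ ℝ² | b < d}`. -/
abbrev BirthDeathPlane : Type := {p : ℝ × ℝ // p.1 < p.2}

/-- The multiplicity of `(b, d) ∈ Δ` in the persistence diagram `Dgm_ℓ(X)`: the number of
classes that are born at radius `b` and die at radius `d`, i.e. that live exactly for the radii in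
`[b, d)`. It is the eventual value, as `ε ↓ 0`, of
`(β^{b, d-ε} - β^{b-ε, d-ε}) - (β^{b, d} - β^{b-ε, d})`: the number of intervals of the barcode
with birth in `(b-ε, b]` and death in `(d-ε, d]`. -/
def diagramMultiplicity (F : Type*) [Field F] {E : Type*} [PseudoMetricSpace E] (X : Set E) (ℓ : ℕ)
    (p : BirthDeathPlane) : ℕ :=
  (limUnder (𝓝[>] (0 : ℝ)) fun ε : ℝ =>
    ((persistentBetti F X ℓ p.1.1 (p.1.2 - ε) : ℤ)
        - persistentBetti F X ℓ (p.1.1 - ε) (p.1.2 - ε))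
      - ((persistentBetti F X ℓ p.1.1 p.1.2 : ℤ)
        - persistentBetti F X ℓ (p.1.1 - ε) p.1.2)).toNat

/-! ### Persistence diagram measures -/

/-- The sum of the Dirac measures at the points, counted with multiplicity, of the union over
`ℓ = 0, …, n - 1` of the persistence diagrams of the atoms of `μ` in `A`. -/
def persistenceDiagramMeasure (F : Type*) [Field F] {n : ℕ}
    (μ : Measure (EuclideanSpace ℝ (Fin n))) (A : Set (EuclideanSpace ℝ (Fin n))) :
    Measure BirthDeathPlane :=
  ∑ ℓ ∈ Finset.range n, Measure.sum fun p : BirthDeathPlane =>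
    (diagramMultiplicity F (atomsIn μ A) ℓ p : ℝ≥0∞) • Measure.dirac p

/-- A Radon measure: finite on relatively compact Borel sets. -/
def IsRadonMeasure {S : Type*} [TopologicalSpace S] [MeasurableSpace S] (μ : Measure S) : Prop :=
  ∀ B : Set S, MeasurableSet B → IsCompact (closure B) → μ B < ∞

/-- `𝔭` is the persistence diagram expectation measure of `ξ`: for every bounded Borel set `A` the
persistence diagram measure `ω ↦ ρ_ω(A)` is a point process on `Δ`, and its first moment measure
`B ↦ 𝔼[ρ(A)(B)]` is the Radon measure `𝔭 A`. -/
structure IsPersistenceDiagramExpectationMeasure (F : Type*) [Field F] {Ω : Type*}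
    [MeasurableSpace Ω] (P : Measure Ω) {n : ℕ} (ξ : Ω → Measure (EuclideanSpace ℝ (Fin n)))
    (𝔭 : Set (EuclideanSpace ℝ (Fin n)) → Measure BirthDeathPlane) : Prop where
  isPointProcess : ∀ A, MeasurableSet A → IsBounded A →
    IsPointProcess fun ω => persistenceDiagramMeasure F (ξ ω) A
  apply_eq : ∀ A, MeasurableSet A → IsBounded A → ∀ B, MeasurableSet B →
    𝔭 A B = ∫⁻ ω, persistenceDiagramMeasure F (ξ ω) A B ∂P
  isRadonMeasure : ∀ A, MeasurableSet A → IsBounded A → IsRadonMeasure (𝔭 A)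

end

noncomputable section

/-! ### Persistent Betti numbers in terms of sets of tuples -/

section PersistentRank

/-! The diagram of a finite point set is a finite, explicitly computable object. Once `N` points are
enumerated, each tuple of indices enters the Čech filtration at its critical radius, and a
persistent Betti number is the dimension of the cycles on one set of index tuples modulo the
boundaries from another (`persistentBetti_range`). It therefore depends only on comparisons between
critical radii and the thresholds, and there are finitely many possible outcomes. Since critical
radii are Borel functions of the points (`measurable_critRadius`), so is the mass that the diagram
gives to a Borel set (`measurable_tupleMass`).

To pass to a random set of atoms without choosing a measurable enumeration, product measures are
used: an integer-valued finite measure is purely atomic, so a set of `k`-tuples contains a tuple of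
atoms exactly when its `k`-fold product measure is nonzero. Functionals of the atoms that are
measurable in injective enumerations are then measurable in `ω` (`measurable_comp_atoms`).

Diagram points lie among the pairs of critical radii, so the degree `ℓ` diagram has total mass at
most `2 * N ^ (3 * ℓ + 4)`. As `N ≤ ξ(A)`, the moment assumption makes the expected total mass
finite, and the expectation measure is the mixture `P.bind` of the diagram measures. -/

/-- Since `Z` surjects onto its quotient, the range is the image of `Z` in the target, and the
kernel of that map is `Z ⊓ B'`. Hence `B` drops out, and rank-nullity applies. -/
theorem Subquotient.finrank_range_map {R M : Type*} [Field R] [AddCommGroup M] [Module R M]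
    {Z B Z' B' : Submodule R M} [FiniteDimensional R Z] (hZ : Z ≤ Z') (hB : B ≤ B') :
    Module.finrank R (LinearMap.range (Subquotient.map hZ hB)) =
      Module.finrank R Z - Module.finrank R (Z ⊓ B' : Submodule R M) := by
  set f : Z →ₗ[R] Subquotient Z' B' := (B'.submoduleOf Z').mkQ ∘ₗ Submodule.inclusion hZ
  have hrange : LinearMap.range (Subquotient.map hZ hB) = LinearMap.range f := by
    rw [← LinearMap.range_comp_of_range_eq_top (Subquotient.map hZ hB)
      (Submodule.range_mkQ (B.submoduleOf Z))]
    rfl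
  have hker : LinearMap.ker f = B'.comap Z.subtype := by
    ext z
    rw [LinearMap.mem_ker]
    exact Submodule.Quotient.mk_eq_zero (B'.submoduleOf Z')
  have h := f.finrank_range_add_finrank_ker
  rw [hker, ← Submodule.finrank_map_subtype_eq, Submodule.map_comap_subtype] at h
  rw [hrange]
  omega

variable (F : Type*) [Field F] {V W : Type*}

/-- The cycles supported on a set of `ℓ`-tuples. -/
def cyclesOn : (ℓ : ℕ) → Set (Fin (ℓ + 1) → V) → Submodule F ((Fin (ℓ + 1) → V) →₀ F)
  | 0, S => Finsupp.supported F F S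
  | ℓ + 1, S => Finsupp.supported F F S ⊓ LinearMap.ker (boundaryMap F V ℓ)

/-- The boundaries of the chains supported on a set of tuples. -/
def boundariesOn (ℓ : ℕ) (S : Set (Fin (ℓ + 2) → V)) :
    Submodule F ((Fin (ℓ + 1) → V) →₀ F) :=
  (Finsupp.supported F F S).map (boundaryMap F V ℓ)

/-- The dimension of the cycles on `S` modulo the boundaries on `T`. -/
def persistentRank (ℓ : ℕ) (S : Set (Fin (ℓ + 1) → V)) (T : Set (Fin (ℓ + 2) → V)) : ℕ :=
  Module.finrank F (cyclesOn F ℓ S) -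
    Module.finrank F (cyclesOn F ℓ S ⊓ boundariesOn F ℓ T : Submodule F _)

variable {F}

theorem cyclesOn_le_supported (ℓ : ℕ) (S : Set (Fin (ℓ + 1) → V)) :
    cyclesOn F ℓ S ≤ Finsupp.supported F F S := by
  cases ℓ with
  | zero => exact le_rfl
  | succ ℓ => exact inf_le_left

theorem cycles_eq_cyclesOn (K : PreAbstractSimplicialComplex V) (ℓ : ℕ) :
    cycles F K ℓ = cyclesOn F ℓ (orderedSimplices K ℓ) := by
  cases ℓ <;> rfl

theorem persistentRank_le_card [Fintype V] (ℓ : ℕ) (S : Set (Fin (ℓ + 1) → V))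
    (T : Set (Fin (ℓ + 2) → V)) :
    persistentRank F ℓ S T ≤ Fintype.card V ^ (ℓ + 1) := by
  classical
  calc persistentRank F ℓ S T ≤ Module.finrank F (cyclesOn F ℓ S) := Nat.sub_le _ _
    _ ≤ Module.finrank F ((Fin (ℓ + 1) → V) →₀ F) := Submodule.finrank_le _
    _ = Fintype.card V ^ (ℓ + 1) := by simp

theorem boundaryMap_lmapDomain (f : V → W) (ℓ : ℕ) (c : (Fin (ℓ + 2) → V) →₀ F) :
    boundaryMap F W ℓ (Finsupp.lmapDomain F F (fun v => f ∘ v) c) =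
      Finsupp.lmapDomain F F (fun v => f ∘ v) (boundaryMap F V ℓ c) := by
  simp only [boundaryMap, LinearMap.sum_apply, LinearMap.smul_apply, map_sum, map_smul,
    Finsupp.lmapDomain_apply, ← Finsupp.mapDomain_comp]
  rfl

theorem boundariesOn_image (f : V → W) (ℓ : ℕ) (T : Set (Fin (ℓ + 2) → V)) :
    boundariesOn F ℓ ((fun v => f ∘ v) '' T) =
      (boundariesOn F ℓ T).map (Finsupp.lmapDomain F F (fun v => f ∘ v)) := by
  unfold boundariesOn
  rw [← Finsupp.lmapDomain_supported, ← Submodule.map_comp, ← Submodule.map_comp]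
  congr 1
  exact LinearMap.ext (boundaryMap_lmapDomain f ℓ)

theorem lmapDomain_comp_injective {f : V → W} (hf : Function.Injective f) (m : ℕ) :
    Function.Injective (Finsupp.lmapDomain F F (fun v : Fin m → V => f ∘ v)) :=
  Finsupp.mapDomain_injective hf.comp_left

theorem cyclesOn_image {f : V → W} (hf : Function.Injective f) (ℓ : ℕ)
    (S : Set (Fin (ℓ + 1) → V)) :
    cyclesOn F ℓ ((fun v => f ∘ v) '' S) =
      (cyclesOn F ℓ S).map (Finsupp.lmapDomain F F (fun v => f ∘ v)) := by
  cases ℓ with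
  | zero => exact (Finsupp.lmapDomain_supported F F _ _).symm
  | succ ℓ =>
    simp only [cyclesOn]
    rw [← Finsupp.lmapDomain_supported]
    ext c
    simp only [Submodule.mem_inf, Submodule.mem_map, LinearMap.mem_ker]
    constructor
    · rintro ⟨⟨d, hd, rfl⟩, h⟩
      refine ⟨d, ⟨hd, lmapDomain_comp_injective hf _ ?_⟩, rfl⟩
      rw [← boundaryMap_lmapDomain, h, map_zero]
    · rintro ⟨d, ⟨hd, h⟩, rfl⟩
      exact ⟨⟨d, hd, rfl⟩, by rw [boundaryMap_lmapDomain, h, map_zero]⟩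

/-- Relabelling vertices commutes with the boundary map, and an injective relabelling preserves
dimensions. This moves the computation from points of space to the fixed finite vertex set `Fin k`.
-/
theorem persistentRank_image {f : V → W} (hf : Function.Injective f) (ℓ : ℕ)
    (S : Set (Fin (ℓ + 1) → V)) (T : Set (Fin (ℓ + 2) → V)) :
    persistentRank F ℓ ((fun v => f ∘ v) '' S) ((fun v => f ∘ v) '' T) =
      persistentRank F ℓ S T := by
  have hinj := lmapDomain_comp_injective (F := F) hf (ℓ + 1)
  unfold persistentRank
  rw [cyclesOn_image hf, boundariesOn_image, ← Submodule.map_inf _ hinj,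
    ← (Submodule.equivMapOfInjective _ hinj _).finrank_eq,
    ← (Submodule.equivMapOfInjective _ hinj _).finrank_eq]

theorem finrank_range_simplicialHomologyMap {K L : PreAbstractSimplicialComplex V} (h : K ≤ L)
    (ℓ : ℕ) (hK : (orderedSimplices K ℓ).Finite) :
    Module.finrank F (LinearMap.range (simplicialHomologyMap F h ℓ)) =
      persistentRank F ℓ (orderedSimplices K ℓ) (orderedSimplices L (ℓ + 1)) := by
  have := hK.to_subtype
  have : FiniteDimensional F (Finsupp.supported F F (orderedSimplices K ℓ)) :=
    Module.Finite.equiv (Finsupp.supportedEquivFinsupp (orderedSimplices K ℓ)).symm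
  have : FiniteDimensional F (cycles F K ℓ) := by
    rw [cycles_eq_cyclesOn]
    exact Submodule.finiteDimensional_of_le (cyclesOn_le_supported ℓ _)
  rw [simplicialHomologyMap, Subquotient.finrank_range_map, cycles_eq_cyclesOn]
  rfl

end PersistentRank

/-! ### Critical radii -/

section CritRadius

variable {E : Type*} [PseudoMetricSpace E]

/-- Common points of the balls along a convergent sequence stay bounded, so by properness a
subsequence converges, and its limit is a common point of the limiting balls. -/
theorem isClosed_setOf_closedBall_inter_nonempty [ProperSpace E] (ι : Type*) [Nonempty ι] [Countable ι] :
    IsClosed {p : (ι → E) × ℝ | (⋂ j, Metric.closedBall (p.1 j) p.2).Nonempty} := by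
  refine isClosed_of_closure_subset fun p hp => ?_
  obtain ⟨q, hq, hqp⟩ := mem_closure_iff_seq_limit.1 hp
  choose y hy using hq
  simp only [Set.mem_iInter, Metric.mem_closedBall] at hy
  have hpt : ∀ j, Tendsto (fun k => (q k).1 j) atTop (𝓝 (p.1 j)) := fun j =>
    ((continuous_apply j).comp continuous_fst).continuousAt.tendsto.comp hqp
  have hr : Tendsto (fun k => (q k).2) atTop (𝓝 p.2) :=
    continuous_snd.continuousAt.tendsto.comp hqp
  let j₀ := Classical.arbitrary ι
  -- `R` bounds `r_k + dist (q_k j₀) (p j₀)`, hence the distance from the common points `y k` to `p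
  -- j₀`.
  obtain ⟨R, hR⟩ := (hr.add ((hpt j₀).dist (tendsto_const_nhds (x := p.1 j₀)))).bddAbove_range
  obtain ⟨z, -, φ, hφ, hz⟩ := tendsto_subseq_of_bounded
    (Metric.isBounded_closedBall (x := p.1 j₀) (r := R)) (x := y) fun k =>
      (dist_triangle _ _ _).trans ((add_le_add_left (hy k j₀) _).trans (hR ⟨k, rfl⟩))
  exact ⟨z, Set.mem_iInter.2 fun j => le_of_tendsto_of_tendsto'
    (hz.dist ((hpt j).comp hφ.tendsto_atTop)) (hr.comp hφ.tendsto_atTop) fun k => hy (φ k) j⟩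

/-- The smallest radius for which the closed balls around the given points have a common point. -/
def critRadius {ι : Type*} (u : ι → E) : ℝ :=
  sInf {r | (⋂ j, Metric.closedBall (u j) r).Nonempty}

/-- The admissible radii form a closed, nonempty set bounded below by `0`, so the infimum is
attained. The Čech filtration thus consists of sublevel sets of `critRadius`. -/
theorem critRadius_le_iff [ProperSpace E] {ι : Type*} [Nonempty ι] [Finite ι] (u : ι → E)
    (r : ℝ) : critRadius u ≤ r ↔ (⋂ j, Metric.closedBall (u j) r).Nonempty := by
  have hbdd : BddBelow {r | (⋂ j, Metric.closedBall (u j) r).Nonempty} := by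
    refine ⟨0, ?_⟩
    rintro r ⟨y, hy⟩
    exact dist_nonneg.trans (Set.mem_iInter.1 hy (Classical.arbitrary ι))
  have hclosed : IsClosed {r | (⋂ j, Metric.closedBall (u j) r).Nonempty} :=
    (isClosed_setOf_closedBall_inter_nonempty (E := E) ι).preimage
      (f := fun r : ℝ => (u, r)) (by fun_prop)
  have hne : {r | (⋂ j, Metric.closedBall (u j) r).Nonempty}.Nonempty := by
    cases nonempty_fintype ι
    refine ⟨∑ j, dist (u (Classical.arbitrary ι)) (u j), u (Classical.arbitrary ι),
      Set.mem_iInter.2 fun j => ?_⟩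
    exact Finset.single_le_sum (f := fun j => dist (u (Classical.arbitrary ι)) (u j))
      (fun _ _ => dist_nonneg) (Finset.mem_univ j)
  refine ⟨fun h => ?_, fun h => csInf_le hbdd h⟩
  obtain ⟨y, hy⟩ := hclosed.csInf_mem hne hbdd
  exact ⟨y, Set.mem_iInter.2 fun j =>
    Metric.closedBall_subset_closedBall h (Set.mem_iInter.1 hy j)⟩

theorem measurable_critRadius [ProperSpace E] [SecondCountableTopology E] [MeasurableSpace E]
    [BorelSpace E] (ι : Type*) [Nonempty ι] [Finite ι] :
    Measurable (critRadius : (ι → E) → ℝ) := by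
  refine measurable_of_Iic fun r => ?_
  have h : (critRadius : (ι → E) → ℝ) ⁻¹' Set.Iic r =
      (fun u => (u, r)) ⁻¹' {p : (ι → E) × ℝ | (⋂ j, Metric.closedBall (p.1 j) p.2).Nonempty} := by
    ext u
    exact critRadius_le_iff u r
  rw [h]
  exact ((isClosed_setOf_closedBall_inter_nonempty ι).preimage (by fun_prop)).measurableSet

end CritRadius

/-! ### Persistence diagrams of enumerated point sets -/

section Diagram

variable (F : Type*) [Field F]

/-- The multiplicity of `(b, d)` in the persistence diagram in degree `ℓ` of a filtration in which
the `ℓ`-tuples `v` appear at radius `a v` and the `(ℓ + 1)`-tuples `v` appear at radius `c v`. -/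
def tupleMultiplicity {V : Type*} (ℓ : ℕ) (a : (Fin (ℓ + 1) → V) → ℝ) (c : (Fin (ℓ + 2) → V) → ℝ)
    (q : ℝ × ℝ) : ℕ :=
  (((persistentRank F ℓ {v | a v ≤ q.1} {v | c v < q.2} : ℤ)
      - persistentRank F ℓ {v | a v < q.1} {v | c v < q.2})
    - ((persistentRank F ℓ {v | a v ≤ q.1} {v | c v ≤ q.2} : ℤ)
      - persistentRank F ℓ {v | a v < q.1} {v | c v ≤ q.2})).toNat

variable {F}

/-- Only two of the four ranks enter with a positive sign, whence the factor `2`. -/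
theorem tupleMultiplicity_le {V : Type*} [Fintype V] (ℓ : ℕ) (a : (Fin (ℓ + 1) → V) → ℝ)
    (c : (Fin (ℓ + 2) → V) → ℝ) (q : ℝ × ℝ) :
    tupleMultiplicity F ℓ a c q ≤ 2 * Fintype.card V ^ (ℓ + 1) := by
  have h₁ := persistentRank_le_card (F := F) ℓ {v | a v ≤ q.1} {v | c v < q.2}
  have h₂ := persistentRank_le_card (F := F) ℓ {v | a v < q.1} {v | c v ≤ q.2}
  unfold tupleMultiplicity
  omega

/-- If `q.1` is not a value of `a`, the strict and weak sublevel sets of `a` agree; otherwise `q.2`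
is not a value of `c` and those of `c` agree. Either way the alternating sum cancels. The diagram is
thus supported on the finite set of pairs of critical radii. -/
theorem tupleMultiplicity_eq_zero {V : Type*} (ℓ : ℕ) (a : (Fin (ℓ + 1) → V) → ℝ)
    (c : (Fin (ℓ + 2) → V) → ℝ) (q : ℝ × ℝ) (hq : ∀ v w, (a v, c w) ≠ q) :
    tupleMultiplicity F ℓ a c q = 0 := by
  unfold tupleMultiplicity
  by_cases h : ∃ v, a v = q.1
  · obtain ⟨v, hv⟩ := h
    have hc : {w | c w < q.2} = {w | c w ≤ q.2} :=
      Set.ext fun w => ⟨fun hw => le_of_lt (α := ℝ) hw, fun hw => lt_of_le_of_ne hw fun hw' => hq v w (Prod.ext hv hw')⟩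
    rw [hc]
    simp
  · have ha : {v | a v < q.1} = {v | a v ≤ q.1} :=
      Set.ext fun v => ⟨fun hv => le_of_lt (α := ℝ) hv, fun hv => lt_of_le_of_ne hv fun hv' => h ⟨v, hv'⟩⟩
    rw [ha]
    simp

/-- Finitely many values leave a gap just below `b`. This turns the limit `ε ↓ 0` defining the
multiplicity into strict inequalities. -/
theorem eventually_le_sub_iff_lt {ι : Type*} [Finite ι] (a : ι → ℝ) (b : ℝ) :
    ∀ᶠ ε in 𝓝[>] (0 : ℝ), ∀ i, a i ≤ b - ε ↔ a i < b := by
  refine eventually_all.2 fun i => ?_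
  rcases lt_or_ge (a i) b with h | h
  · filter_upwards [Ioo_mem_nhdsGT (sub_pos.2 h)] with ε hε
    exact ⟨fun _ => h, fun _ => by linarith [hε.2]⟩
  · filter_upwards [self_mem_nhdsWithin] with ε hε
    have : 0 < ε := hε
    exact ⟨fun _ => by linarith, fun _ => by linarith⟩

variable {E : Type*} [PseudoMetricSpace E] [ProperSpace E]

theorem orderedSimplices_cechComplex_range {V : Type*} (x : V → E) (r : ℝ) (ℓ : ℕ) :
    orderedSimplices (cechComplex (Set.range x) r) ℓ =
      (fun v => x ∘ v) '' {v : Fin (ℓ + 1) → V | critRadius (x ∘ v) ≤ r} := by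
  classical
  ext u
  constructor
  · rintro ⟨σ, ⟨-, hX, y, hy⟩, hu⟩
    rw [hu] at hX
    choose v hv using fun j => hX (Set.mem_range_self j)
    have hv' : x ∘ v = u := funext hv
    refine ⟨v, ?_, hv'⟩
    rw [Set.mem_ofPred_eq, hv', critRadius_le_iff]
    refine ⟨y, Set.mem_iInter.2 fun j => ?_⟩
    have hj : u j ∈ σ := by
      rw [← Finset.mem_coe, hu]
      exact Set.mem_range_self j
    exact Set.mem_iInter₂.1 hy (u j) hj
  · rintro ⟨v, hv, rfl⟩
    obtain ⟨y, hy⟩ := (critRadius_le_iff _ _).1 hv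
    refine ⟨Finset.univ.image (x ∘ v), ⟨Finset.univ_nonempty.image _, ?_, y, ?_⟩, ?_⟩
    · rw [Finset.coe_image, Finset.coe_univ, Set.image_univ]
      exact Set.range_comp_subset_range v x
    · simpa [Set.mem_iInter] using hy
    · rw [Finset.coe_image, Finset.coe_univ, Set.image_univ]

theorem persistentBetti_range {V : Type*} [Finite V] {x : V → E} (hx : Function.Injective x)
    (ℓ : ℕ) {r s : ℝ} (h : r ≤ s) :
    persistentBetti F (Set.range x) ℓ r s =
      persistentRank F ℓ {v | critRadius (x ∘ v) ≤ r} {v | critRadius (x ∘ v) ≤ s} := by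
  rw [persistentBetti, dif_pos h, finrank_range_simplicialHomologyMap,
    orderedSimplices_cechComplex_range, orderedSimplices_cechComplex_range,
    persistentRank_image hx]
  rw [orderedSimplices_cechComplex_range]
  exact (Set.toFinite _).image _

theorem diagramMultiplicity_range {V : Type*} [Finite V] {x : V → E} (hx : Function.Injective x)
    (ℓ : ℕ) (p : BirthDeathPlane) :
    diagramMultiplicity F (Set.range x) ℓ p =
      tupleMultiplicity F ℓ (fun v => critRadius (x ∘ v)) (fun v => critRadius (x ∘ v)) p.1 := by
  rw [diagramMultiplicity, tupleMultiplicity]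
  congr 1
  -- The expression is eventually constant in `ε`. Taking `ε < d - b` keeps `b ≤ d - ε`, so the
  -- default value of `persistentBetti` never occurs.
  refine (tendsto_const_nhds.congr' ?_).limUnder_eq
  filter_upwards [eventually_le_sub_iff_lt (fun v : Fin (ℓ + 1) → V => critRadius (x ∘ v)) p.1.1,
    eventually_le_sub_iff_lt (fun v : Fin (ℓ + 2) → V => critRadius (x ∘ v)) p.1.2,
    Ioo_mem_nhdsGT (sub_pos.2 p.2)] with ε hb hd hε
  have h₁ : p.1.1 ≤ p.1.2 - ε := by linarith [hε.2]
  have h₂ : p.1.1 - ε ≤ p.1.2 - ε := by linarith [p.2]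
  have h₃ : p.1.1 - ε ≤ p.1.2 := by linarith [hε.1]
  rw [persistentBetti_range hx ℓ h₁, persistentBetti_range hx ℓ h₂,
    persistentBetti_range hx ℓ p.2.le, persistentBetti_range hx ℓ h₃]
  simp only [hb, hd]

end Diagram

/-! ### The measure of a persistence diagram -/

section DiagramMeasure

variable {F : Type*} [Field F]

/-- The measure of the image in the plane of a set of birth-death pairs, as a finite sum. -/
def tupleMass (F : Type*) [Field F] {V : Type*} [Fintype V] (ℓ : ℕ)
    (a : (Fin (ℓ + 1) → V) → ℝ) (c : (Fin (ℓ + 2) → V) → ℝ) (B : Set (ℝ × ℝ)) : ℝ≥0∞ :=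
  open Classical in
  ∑ q ∈ Finset.univ.image fun i : (Fin (ℓ + 1) → V) × (Fin (ℓ + 2) → V) => (a i.1, c i.2),
    B.indicator (fun q => (tupleMultiplicity F ℓ a c q : ℝ≥0∞)) q

variable {V : Type*} [Fintype V]

theorem exists_nat_tupleMass (ℓ : ℕ) (a : (Fin (ℓ + 1) → V) → ℝ) (c : (Fin (ℓ + 2) → V) → ℝ)
    (B : Set (ℝ × ℝ)) : ∃ k : ℕ, tupleMass F ℓ a c B = k := by
  classical
  refine ⟨∑ q ∈ Finset.univ.image fun i : (Fin (ℓ + 1) → V) × (Fin (ℓ + 2) → V) =>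
    (a i.1, c i.2), B.indicator (fun q => tupleMultiplicity F ℓ a c q) q, ?_⟩
  rw [tupleMass, Nat.cast_sum]
  refine Finset.sum_congr rfl fun q _ => ?_
  by_cases h : q ∈ B <;> simp [h]

/-- With `N` vertices there are at most `N ^ (ℓ + 1) * N ^ (ℓ + 2)` pairs of critical radii, each of
multiplicity at most `2 * N ^ (ℓ + 1)`. -/
theorem tupleMass_le (ℓ : ℕ) (a : (Fin (ℓ + 1) → V) → ℝ) (c : (Fin (ℓ + 2) → V) → ℝ)
    (B : Set (ℝ × ℝ)) :
    tupleMass F ℓ a c B ≤ 2 * (Fintype.card V : ℝ≥0∞) ^ (3 * ℓ + 4) := by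
  classical
  calc tupleMass F ℓ a c B
      ≤ ∑ q ∈ Finset.univ.image fun i : (Fin (ℓ + 1) → V) × (Fin (ℓ + 2) → V) =>
          (a i.1, c i.2), ((2 * Fintype.card V ^ (ℓ + 1) : ℕ) : ℝ≥0∞) := by
        refine Finset.sum_le_sum fun q _ => (Set.indicator_le_self _ _ _).trans ?_
        exact_mod_cast tupleMultiplicity_le ℓ a c q
    _ ≤ ((Fintype.card V ^ (ℓ + 1) * Fintype.card V ^ (ℓ + 2) : ℕ) : ℝ≥0∞) *
          ((2 * Fintype.card V ^ (ℓ + 1) : ℕ) : ℝ≥0∞) := by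
        rw [Finset.sum_const, nsmul_eq_mul]
        gcongr
        refine Finset.card_image_le.trans ?_
        simp
    _ = 2 * (Fintype.card V : ℝ≥0∞) ^ (3 * ℓ + 4) := by
        push_cast
        ring

/-- The index set varies with `x`, because values may coincide. Summing over `ι` instead, with each
term divided by the number of indices sharing its value, counts every value once and is visibly
measurable. -/
theorem measurable_sum_image {α β ι : Type*} [MeasurableSpace α] [MeasurableSpace β]
    [MeasurableEq β] [DecidableEq β] [Fintype ι] {f : ι → α → β} {w : α → β → ℝ≥0∞}
    (hf : ∀ i, Measurable (f i)) (hw : ∀ i, Measurable fun x => w x (f i x)) :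
    Measurable fun x => ∑ b ∈ Finset.univ.image fun i => f i x, w x b := by
  have h : ∀ x, ∑ b ∈ Finset.univ.image (fun i => f i x), w x b =
      ∑ i, w x (f i x) / ∑ j, if f j x = f i x then 1 else 0 := by
    intro x
    rw [Finset.sum_comp (fun b => w x b / ∑ j, if f j x = b then 1 else 0) fun i => f i x]
    refine Finset.sum_congr rfl fun b hb => ?_
    obtain ⟨i, -, hi⟩ := Finset.mem_image.1 hb
    have hcard : (Finset.univ.filter fun j => f j x = b).card ≠ 0 :=
      Finset.card_ne_zero_of_mem (a := i) (by simpa using hi)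
    rw [Finset.sum_boole, nsmul_eq_mul, ENNReal.mul_div_cancel (by exact_mod_cast hcard)
      (ENNReal.natCast_ne_top _)]
  simp_rw [h]
  refine Finset.measurable_sum _ fun i _ => (hw i).div <| Finset.measurable_sum _ fun j _ => ?_
  exact Measurable.ite (measurableSet_eq_fun (hf j) (hf i)) measurable_const measurable_const

/-- Finite types have finitely many subsets, so every function of two such subsets is measurable. No
measurability of ranks as such needs checking. -/
theorem Measurable.comp_sets_of_finite {α β β' γ : Type*} [Finite β] [Finite β']
    [MeasurableSpace α] [MeasurableSpace γ] (f : Set β → Set β' → γ) {S : α → Set β}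
    {T : α → Set β'} (hS : Measurable S) (hT : Measurable T) :
    Measurable fun x => f (S x) (T x) := by
  have h : Measurable (Function.uncurry f) := .of_discrete
  exact h.comp (hS.prodMk hT)

theorem measurable_persistentRank {α : Type*} [MeasurableSpace α] {ℓ : ℕ}
    {S : α → Set (Fin (ℓ + 1) → V)} {T : α → Set (Fin (ℓ + 2) → V)} (hS : Measurable S)
    (hT : Measurable T) : Measurable fun x => (persistentRank F ℓ (S x) (T x) : ℤ) :=
  Measurable.comp_sets_of_finite (fun S T => (persistentRank F ℓ S T : ℤ)) hS hT

theorem measurable_tupleMultiplicity {α : Type*} [MeasurableSpace α] {ℓ : ℕ}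
    {a : α → (Fin (ℓ + 1) → V) → ℝ} {c : α → (Fin (ℓ + 2) → V) → ℝ} {q : α → ℝ × ℝ}
    (ha : Measurable a) (hc : Measurable c) (hq : Measurable q) :
    Measurable fun x => tupleMultiplicity F ℓ (a x) (c x) (q x) := by
  have h₁ : Measurable fun x => {v | a x v ≤ (q x).1} := measurable_set_iff.2 fun v =>
    measurableSet_setOfPred.1 (measurableSet_le ((measurable_pi_apply v).comp ha) hq.fst)
  have h₂ : Measurable fun x => {v | a x v < (q x).1} := measurable_set_iff.2 fun v =>
    measurableSet_setOfPred.1 (measurableSet_lt ((measurable_pi_apply v).comp ha) hq.fst)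
  have h₃ : Measurable fun x => {v | c x v ≤ (q x).2} := measurable_set_iff.2 fun v =>
    measurableSet_setOfPred.1 (measurableSet_le ((measurable_pi_apply v).comp hc) hq.snd)
  have h₄ : Measurable fun x => {v | c x v < (q x).2} := measurable_set_iff.2 fun v =>
    measurableSet_setOfPred.1 (measurableSet_lt ((measurable_pi_apply v).comp hc) hq.snd)
  have h := ((measurable_persistentRank (F := F) h₁ h₄).sub
    (measurable_persistentRank (F := F) h₂ h₄)).sub
    ((measurable_persistentRank (F := F) h₁ h₃).sub (measurable_persistentRank (F := F) h₂ h₃))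
  unfold tupleMultiplicity
  exact (Measurable.of_discrete (f := Int.toNat)).comp h

theorem measurable_tupleMass {α : Type*} [MeasurableSpace α] {ℓ : ℕ}
    {a : α → (Fin (ℓ + 1) → V) → ℝ} {c : α → (Fin (ℓ + 2) → V) → ℝ}
    (ha : Measurable a) (hc : Measurable c) {B : Set (ℝ × ℝ)} (hB : MeasurableSet B) :
    Measurable fun x => tupleMass F ℓ (a x) (c x) B := by
  classical
  have hf : ∀ i : (Fin (ℓ + 1) → V) × (Fin (ℓ + 2) → V),
      Measurable fun x => (a x i.1, c x i.2) := fun i =>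
    ((measurable_pi_apply _).comp ha).prodMk ((measurable_pi_apply _).comp hc)
  refine measurable_sum_image hf fun i => ?_
  have h := (Measurable.of_discrete (f := fun k : ℕ => (k : ℝ≥0∞))).comp
    (measurable_tupleMultiplicity (F := F) ha hc (hf i))
  simp only [Set.indicator_apply]
  exact Measurable.ite (hf i hB) h measurable_const

/-- The sum over the uncountable plane collapses to the pairs of critical radii, outside which the
multiplicity vanishes. Pairs off the half plane contribute nothing because `B` lies inside it. -/
theorem sum_diagramMultiplicity_dirac_range {E : Type*} [PseudoMetricSpace E] [ProperSpace E]
    {x : V → E} (hx : Function.Injective x) (ℓ : ℕ) {B : Set BirthDeathPlane}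
    (hB : MeasurableSet B) :
    Measure.sum (fun p : BirthDeathPlane =>
        (diagramMultiplicity F (Set.range x) ℓ p : ℝ≥0∞) • Measure.dirac p) B =
      tupleMass F ℓ (fun v => critRadius (x ∘ v)) (fun v => critRadius (x ∘ v))
        (Subtype.val '' B) := by
  classical
  set w : ℝ × ℝ → ℝ≥0∞ := (Subtype.val '' B).indicator fun q => (tupleMultiplicity F ℓ
    (fun v => critRadius (x ∘ v)) (fun v => critRadius (x ∘ v)) q : ℝ≥0∞) with hw
  have hterm : ∀ p : BirthDeathPlane,
      ((diagramMultiplicity F (Set.range x) ℓ p : ℝ≥0∞) • Measure.dirac p) B = w p.1 := by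
    intro p
    rw [Measure.smul_apply, Measure.dirac_apply' _ hB, diagramMultiplicity_range hx]
    by_cases hp : p ∈ B
    · have hp' : p.1 ∈ Subtype.val '' B := ⟨p, hp, rfl⟩
      rw [hw, Set.indicator_of_mem hp', Set.indicator_of_mem hp]
      simp
    · have hp' : p.1 ∉ Subtype.val '' B := by
        rintro ⟨p', h, h'⟩
        exact hp (Subtype.ext h' ▸ h)
      rw [hw, Set.indicator_of_notMem hp', Set.indicator_of_notMem hp]
      simp
  have hsupp : Function.support w ⊆ {q : ℝ × ℝ | q.1 < q.2} := by
    intro q hq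
    obtain ⟨p, -, rfl⟩ := Set.mem_of_indicator_ne_zero hq
    exact p.2
  rw [Measure.sum_apply _ hB, tsum_congr hterm]
  refine (tsum_subtype_eq_of_support_subset hsupp).trans ?_
  rw [tupleMass]
  refine tsum_eq_sum fun q hq => ?_
  simp only [Finset.mem_image, Finset.mem_univ, true_and, not_exists] at hq
  have h0 := tupleMultiplicity_eq_zero (F := F) ℓ (fun v => critRadius (x ∘ v))
    (fun v => critRadius (x ∘ v)) q fun v u h => hq (v, u) h
  simp only [hw, Set.indicator_apply, h0, Nat.cast_zero, ite_self]

end DiagramMeasure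

/-! ### Random finite sets of atoms -/

section Atoms

theorem Measurable.restrict_measure {Ω S : Type*} [MeasurableSpace Ω] [MeasurableSpace S]
    {ν : Ω → Measure S} (hν : Measurable ν) {A : Set S} (hA : MeasurableSet A) :
    Measurable fun ω => (ν ω).restrict A := by
  refine Measure.measurable_of_measurable_coe _ fun B hB => ?_
  simp_rw [Measure.restrict_apply hB]
  exact (Measure.measurable_coe (hB.inter hA)).comp hν

variable {E : Type*} [MeasurableSpace E]

/-- Around a point that is not an atom, closed balls shrink to measure `0`. Their measures are
integers, so some ball is already null. Second countability passes from locally null to null. -/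
theorem measure_setOf_singleton_eq_zero [MetricSpace E] [OpensMeasurableSpace E]
    [SecondCountableTopology E] (ν : Measure E) [IsFiniteMeasure ν]
    (hν : ∀ B, MeasurableSet B → ∃ k : ℕ, ν B = k) : ν {x | ν {x} = 0} = 0 := by
  refine measure_null_of_locally_null _ fun x hx => ?_
  have hx : ν {x} = 0 := hx
  have h := tendsto_measure_biInter_gt (μ := ν) (s := Metric.closedBall x) (a := (0 : ℝ))
    (fun r _ => Metric.isClosed_closedBall.nullMeasurableSet)
    (fun _ _ _ h => Metric.closedBall_subset_closedBall h) ⟨1, one_pos, measure_ne_top _ _⟩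
  have hI : ⋂ r > (0 : ℝ), Metric.closedBall x r = {x} := by
    ext y
    simp only [Set.mem_iInter, Metric.mem_closedBall, Set.mem_singleton_iff]
    exact ⟨fun h => dist_le_zero.1 (le_of_forall_gt_imp_ge_of_dense h),
      fun h r hr => by simpa [h] using hr.le⟩
  rw [hI, hx] at h
  obtain ⟨r, hr, hr0⟩ := ((h.eventually_lt_const one_pos).and self_mem_nhdsWithin).exists
  refine ⟨_, mem_nhdsWithin_of_mem_nhds (Metric.closedBall_mem_nhds x hr0), ?_⟩
  obtain ⟨k, hk⟩ := hν _ (Metric.isClosed_closedBall (x := x) (ε := r)).measurableSet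
  have hr : ν (Metric.closedBall x r) < 1 := hr
  rw [hk] at hr ⊢
  have : k < 1 := by exact_mod_cast hr
  simp [Nat.lt_one_iff.1 this]

/-- When `ν` is carried by its atoms, almost every tuple consists of atoms, and each tuple of atoms
has positive product mass. An existential statement about atoms becomes the evaluation of a measure,
which is measurable in `ν`. -/
theorem pi_ne_zero_iff {ι : Type*} [Fintype ι] (ν : Measure E)
    [IsFiniteMeasure ν] (hν : ν {x | ν {x} = 0} = 0) (G : Set (ι → E)) :
    Measure.pi (fun _ => ν) G ≠ 0 ↔ ∃ x ∈ G, ∀ i, ν {x i} ≠ 0 := by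
  constructor
  · contrapose!
    intro h
    refine measure_mono_null (t := ⋃ i, Function.eval i ⁻¹' {x | ν {x} = 0})
      (fun x hx => Set.mem_iUnion.2 (h x hx)) (measure_iUnion_null fun i => ?_)
    exact Measure.pi_eval_preimage_null _ hν
  · rintro ⟨x, hx, h⟩ h0
    have := measure_mono_null (Set.singleton_subset_iff.2 hx) h0
    rw [Measure.pi_singleton] at this
    exact Finset.prod_ne_zero_iff.2 (fun i _ => h i) this

theorem measurable_measure_pi {Ω ι : Type*} [MeasurableSpace Ω] [Fintype ι] {ν : Ω → Measure E}
    [∀ ω, IsFiniteMeasure (ν ω)] (hν : Measurable ν) :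
    Measurable fun ω => Measure.pi fun _ : ι => ν ω := by
  refine Measurable.measure_of_isPiSystem generateFrom_pi.symm isPiSystem_pi ?_ ?_
  · rintro _ ⟨s, hs, rfl⟩
    simp_rw [Measure.pi_pi]
    exact Finset.measurable_prod _ fun i _ =>
      (Measure.measurable_coe (hs i (Set.mem_univ i))).comp hν
  · simp_rw [Measure.pi_univ]
    exact Finset.measurable_prod _ fun i _ => (Measure.measurable_coe .univ).comp hν

/-- A functional of the finite random set of atoms is measurable if it is given by measurable
functions of the injective enumerations of the set. -/
theorem measurable_comp_atoms [MeasurableEq E] {Ω γ : Type*} [MeasurableSpace Ω]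
    [MeasurableSpace γ] {ν : Ω → Measure E} [∀ ω, IsFiniteMeasure (ν ω)] (hν : Measurable ν)
    (hatom : ∀ ω, ν ω {x | ν ω {x} = 0} = 0) (hfin : ∀ ω, {x | ν ω {x} ≠ 0}.Finite)
    (Φ : Set E → γ) (h : ∀ k, (Fin k → E) → γ) (hm : ∀ k, Measurable (h k))
    (hΦ : ∀ k (x : Fin k → E), Function.Injective x → Φ (Set.range x) = h k x) :
    Measurable fun ω => Φ {x | ν ω {x} ≠ 0} := by
  have hinj : ∀ k, MeasurableSet {x : Fin k → E | Function.Injective x} := by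
    intro k
    have : {x : Fin k → E | Function.Injective x} =
        ⋂ (i) (j) (_ : i ≠ j), {x | x i = x j}ᶜ := by
      ext x
      simp only [Set.mem_ofPred_eq, Set.mem_iInter, Set.mem_compl_iff]
      exact ⟨fun hx i j hij e => hij (hx e), fun hx i j e => by_contra fun hij => hx i j hij e⟩
    rw [this]
    exact .iInter fun i => .iInter fun j => .iInter fun _ =>
      (measurableSet_eq_fun (measurable_pi_apply i) (measurable_pi_apply j)).compl
  have hset : ∀ (k : ℕ) {G : Set (Fin k → E)}, MeasurableSet G →
      MeasurableSet {ω | ∃ x ∈ G, ∀ i, ν ω {x i} ≠ 0} := by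
    intro k G hG
    simp_rw [← pi_ne_zero_iff _ (hatom _)]
    exact ((Measure.measurable_coe hG).comp (measurable_measure_pi hν))
      (measurableSet_singleton 0).compl
  intro C hC
  -- The event is split by the number `k` of atoms: some injective `k`-tuple of atoms is mapped into
  -- `C`, and no injective `(k + 1)`-tuple of atoms exists.
  have hpre : (fun ω => Φ {x | ν ω {x} ≠ 0}) ⁻¹' C = ⋃ k,
      {ω | ∃ x ∈ {x : Fin k → E | Function.Injective x} ∩ h k ⁻¹' C, ∀ i, ν ω {x i} ≠ 0} \
        {ω | ∃ x ∈ {x : Fin (k + 1) → E | Function.Injective x}, ∀ i, ν ω {x i} ≠ 0} := by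
    ext ω
    simp only [Set.mem_preimage, Set.mem_iUnion, Set.mem_sdiff, Set.mem_ofPred_eq, Set.mem_inter_iff]
    constructor
    · intro hω
      have hcoe := (hfin ω).coe_toFinset
      set s := (hfin ω).toFinset
      set x : Fin s.card → E := fun i => s.equivFin.symm i with hx
      have hxi : Function.Injective x := Subtype.val_injective.comp s.equivFin.symm.injective
      have hr : Set.range x = {x | ν ω {x} ≠ 0} := by
        rw [hx, ← hcoe]
        exact (s.equivFin.symm.surjective.range_comp Subtype.val).trans Subtype.range_val
      refine ⟨s.card, ⟨x, ⟨hxi, by rwa [← hΦ _ x hxi, hr]⟩, fun i => ?_⟩, ?_⟩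
      · have : x i ∈ Set.range x := ⟨i, rfl⟩
        rwa [hr] at this
      · rintro ⟨y, hyi, hy⟩
        have := Finset.card_le_card_of_injOn (s := Finset.univ) (t := s) y
          (fun i _ => by rw [hcoe]; exact hy i) hyi.injOn
        simp at this
    · rintro ⟨k, ⟨x, ⟨hxi, hxC⟩, hx⟩, hmax⟩
      have hr : Set.range x = {x | ν ω {x} ≠ 0} := by
        refine Set.Subset.antisymm (Set.range_subset_iff.2 hx) fun y hy => ?_
        by_contra hyx
        -- An atom missed by `x` would extend it to an injective `(k + 1)`-tuple of atoms.
        exact hmax ⟨Fin.cons y x, Fin.cons_injective_iff.2 ⟨hyx, hxi⟩, Fin.cases hy hx⟩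
      rw [← hr, hΦ k x hxi]
      exact hxC
  rw [hpre]
  exact .iUnion fun k => (hset k ((hinj k).inter (hm k hC))).diff (hset _ (hinj _))

theorem card_atoms_le [MeasurableSingletonClass E] (ν : Measure E)
    (hν : ∀ x, ν {x} ≠ 0 → 1 ≤ ν {x}) (s : Finset E) (hs : ∀ x ∈ s, ν {x} ≠ 0) :
    (s.card : ℝ≥0∞) ≤ ν Set.univ := by
  calc (s.card : ℝ≥0∞) = ∑ x ∈ s, 1 := by simp
    _ ≤ ∑ x ∈ s, ν {x} := Finset.sum_le_sum fun x hx => hν x (hs x hx)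
    _ = ν s := sum_measure_singleton
    _ ≤ ν Set.univ := measure_mono (Set.subset_univ _)

theorem finite_atoms [MeasurableSingletonClass E] (ν : Measure E) [IsFiniteMeasure ν]
    (hν : ∀ x, ν {x} ≠ 0 → 1 ≤ ν {x}) : {x | ν {x} ≠ 0}.Finite := by
  by_contra hinf
  obtain ⟨k, hk⟩ := ENNReal.exists_nat_gt (measure_ne_top ν Set.univ)
  obtain ⟨s, hs, rfl⟩ := Set.Infinite.exists_subset_card_eq hinf k
  exact hk.not_ge (card_atoms_le ν hν s fun x hx => hs hx)

end Atoms

/-! ### The persistence diagram measure of a point process -/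

section PointProcess

variable {F : Type*} [Field F] {n : ℕ}

theorem measurableSet_birthDeathPlane : MeasurableSet {p : ℝ × ℝ | p.1 < p.2} :=
  measurableSet_lt measurable_fst measurable_snd

variable {Ω : Type*} [MeasurableSpace Ω] {ξ : Ω → Measure (EuclideanSpace ℝ (Fin n))}
  {A : Set (EuclideanSpace ℝ (Fin n))}

theorem atomsIn_eq_restrict {S : Type*} [MeasurableSpace S] [MeasurableSingletonClass S]
    (μ : Measure S) (A : Set S) : atomsIn μ A = {x | μ.restrict A {x} ≠ 0} := by
  ext x
  rw [Set.mem_ofPred_eq, Measure.restrict_apply (measurableSet_singleton x)]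
  by_cases hx : x ∈ A
  · rw [Set.inter_eq_left.2 (Set.singleton_subset_iff.2 hx)]
    exact and_iff_right hx
  · rw [Set.singleton_inter_eq_empty.2 hx]
    simp [atomsIn, hx]

theorem IsPointProcess.exists_nat_restrict (hξ : IsPointProcess ξ) (hA : MeasurableSet A)
    (hb : IsBounded A) (ω : Ω) (B : Set (EuclideanSpace ℝ (Fin n))) (hB : MeasurableSet B) :
    ∃ k : ℕ, (ξ ω).restrict A B = k := by
  rw [Measure.restrict_apply hB]
  exact hξ.exists_nat ω _ (hB.inter hA) (hb.subset Set.inter_subset_right)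

theorem IsPointProcess.isFiniteMeasure_restrict (hξ : IsPointProcess ξ) (hA : MeasurableSet A)
    (hb : IsBounded A) (ω : Ω) : IsFiniteMeasure ((ξ ω).restrict A) := by
  obtain ⟨k, hk⟩ := hξ.exists_nat_restrict hA hb ω _ .univ
  exact ⟨hk ▸ ENNReal.natCast_lt_top k⟩

theorem IsPointProcess.one_le_restrict_singleton (hξ : IsPointProcess ξ) (hA : MeasurableSet A)
    (hb : IsBounded A) (ω : Ω) (x : EuclideanSpace ℝ (Fin n)) (hx : (ξ ω).restrict A {x} ≠ 0) :
    1 ≤ (ξ ω).restrict A {x} := by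
  obtain ⟨k, hk⟩ := hξ.exists_nat_restrict hA hb ω {x} (measurableSet_singleton x)
  rw [hk] at hx ⊢
  exact_mod_cast Nat.one_le_iff_ne_zero.2 (by exact_mod_cast hx)

theorem IsPointProcess.finite_atomsIn (hξ : IsPointProcess ξ) (hA : MeasurableSet A)
    (hb : IsBounded A) (ω : Ω) : (atomsIn (ξ ω) A).Finite := by
  have := hξ.isFiniteMeasure_restrict hA hb ω
  rw [atomsIn_eq_restrict]
  exact finite_atoms _ (hξ.one_le_restrict_singleton hA hb ω)

theorem IsPointProcess.exists_enumeration_atomsIn (hξ : IsPointProcess ξ) (hA : MeasurableSet A)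
    (hb : IsBounded A) (ω : Ω) : ∃ (k : ℕ) (x : Fin k → EuclideanSpace ℝ (Fin n)),
      Function.Injective x ∧ Set.range x = atomsIn (ξ ω) A ∧ (k : ℝ≥0∞) ≤ ξ ω A := by
  have hcoe := (hξ.finite_atomsIn hA hb ω).coe_toFinset
  set s := (hξ.finite_atomsIn hA hb ω).toFinset
  refine ⟨s.card, fun i => s.equivFin.symm i,
    Subtype.val_injective.comp s.equivFin.symm.injective, ?_, ?_⟩
  · rw [← hcoe]
    exact (s.equivFin.symm.surjective.range_comp Subtype.val).trans Subtype.range_val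
  · rw [← Measure.restrict_apply_univ]
    refine card_atoms_le _ (hξ.one_le_restrict_singleton hA hb ω) s fun x hx => ?_
    rw [← Finset.mem_coe, hcoe, atomsIn_eq_restrict] at hx
    exact hx

theorem persistenceDiagramMeasure_apply_of_range {μ : Measure (EuclideanSpace ℝ (Fin n))} {k : ℕ}
    {x : Fin k → EuclideanSpace ℝ (Fin n)} (hx : Function.Injective x)
    (hr : Set.range x = atomsIn μ A) {B : Set BirthDeathPlane} (hB : MeasurableSet B) :
    persistenceDiagramMeasure F μ A B = ∑ ℓ ∈ Finset.range n,
      tupleMass F ℓ (fun v => critRadius (x ∘ v)) (fun v => critRadius (x ∘ v))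
        (Subtype.val '' B) := by
  rw [persistenceDiagramMeasure, Measure.finsetSum_apply, ← hr]
  exact Finset.sum_congr rfl fun ℓ _ => sum_diagramMultiplicity_dirac_range hx ℓ hB

theorem measurable_critRadius_comp {k m : ℕ} :
    Measurable fun (x : Fin k → EuclideanSpace ℝ (Fin n)) (v : Fin (m + 1) → Fin k) =>
      critRadius (x ∘ v) :=
  measurable_pi_lambda _ fun v => (measurable_critRadius (Fin (m + 1))).comp <|
    measurable_pi_lambda _ fun j => measurable_pi_apply (v j)

variable (F)

theorem IsPointProcess.measurable_persistenceDiagramMeasure (hξ : IsPointProcess ξ)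
    (hA : MeasurableSet A) (hb : IsBounded A) :
    Measurable fun ω => persistenceDiagramMeasure F (ξ ω) A := by
  refine Measure.measurable_of_measurable_coe _ fun B hB => ?_
  have := hξ.isFiniteMeasure_restrict hA hb
  have hfin := hξ.finite_atomsIn hA hb
  simp only [atomsIn_eq_restrict] at hfin
  have h := measurable_comp_atoms (ν := fun ω => (ξ ω).restrict A)
    (hξ.measurable.restrict_measure hA)
    (fun ω => measure_setOf_singleton_eq_zero _ (hξ.exists_nat_restrict hA hb ω)) hfin
    (fun X => ∑ ℓ ∈ Finset.range n, Measure.sum (fun p : BirthDeathPlane =>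
      (diagramMultiplicity F X ℓ p : ℝ≥0∞) • Measure.dirac p) B)
    (fun k x => ∑ ℓ ∈ Finset.range n, tupleMass F ℓ (fun v => critRadius (x ∘ v))
      (fun v => critRadius (x ∘ v)) (Subtype.val '' B))
    (fun k => Finset.measurable_sum _ fun ℓ _ => measurable_tupleMass
      measurable_critRadius_comp measurable_critRadius_comp
      (measurableSet_birthDeathPlane.subtype_image hB))
    (fun k x hx => Finset.sum_congr rfl fun ℓ _ => sum_diagramMultiplicity_dirac_range hx ℓ hB)
  simpa only [persistenceDiagramMeasure, Measure.finsetSum_apply, atomsIn_eq_restrict] using h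

theorem IsPointProcess.isPointProcess_persistenceDiagramMeasure (hξ : IsPointProcess ξ)
    (hA : MeasurableSet A) (hb : IsBounded A) :
    IsPointProcess fun ω => persistenceDiagramMeasure F (ξ ω) A where
  measurable := hξ.measurable_persistenceDiagramMeasure F hA hb
  exists_nat ω B hB _ := by
    obtain ⟨k, x, hx, hr, -⟩ := hξ.exists_enumeration_atomsIn hA hb ω
    choose m hm using fun ℓ => exists_nat_tupleMass (F := F) ℓ
      (fun v => critRadius (x ∘ v)) (fun v => critRadius (x ∘ v)) (Subtype.val '' B)
    refine ⟨∑ ℓ ∈ Finset.range n, m ℓ, ?_⟩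
    rw [persistenceDiagramMeasure_apply_of_range hx hr hB, Nat.cast_sum]
    exact Finset.sum_congr rfl fun ℓ _ => hm ℓ

/-- Every atom has integer mass at least one, so the number of points is at most `ξ ω A`, and
`tupleMass_le` applies in each degree. -/
theorem IsPointProcess.persistenceDiagramMeasure_univ_le (hξ : IsPointProcess ξ)
    (hA : MeasurableSet A) (hb : IsBounded A) (ω : Ω) :
    persistenceDiagramMeasure F (ξ ω) A Set.univ ≤
      ∑ ℓ ∈ Finset.range n, 2 * ξ ω A ^ (3 * ℓ + 4) := by
  obtain ⟨k, x, hx, hr, hk⟩ := hξ.exists_enumeration_atomsIn hA hb ω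
  rw [persistenceDiagramMeasure_apply_of_range hx hr .univ]
  refine Finset.sum_le_sum fun ℓ _ => (tupleMass_le ℓ _ _ _).trans ?_
  rw [Fintype.card_fin]
  gcongr

theorem lintegral_persistenceDiagramMeasure_univ_lt_top (P : Measure Ω) (hξ : IsPointProcess ξ)
    (hmom : HasAllFiniteMoments P ξ) (hA : MeasurableSet A) (hb : IsBounded A) :
    ∫⁻ ω, persistenceDiagramMeasure F (ξ ω) A Set.univ ∂P < ∞ := by
  have hm : Measurable fun ω => ξ ω A := (Measure.measurable_coe hA).comp hξ.measurable
  refine (lintegral_mono (hξ.persistenceDiagramMeasure_univ_le F hA hb)).trans_lt ?_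
  rw [lintegral_finsetSum _ fun ℓ _ => (hm.pow_const _).const_mul _]
  refine ENNReal.sum_lt_top.2 fun ℓ _ => ?_
  rw [lintegral_const_mul _ (hm.pow_const _)]
  exact ENNReal.mul_lt_top (by simp) (hmom _ (by omega) A hA hb)

end PointProcess

end

theorem mainTheorem9 (F : Type*) [Field F] {Ω : Type*} [MeasurableSpace Ω] (P : Measure Ω)
    [IsProbabilityMeasure P] (n : ℕ) (ξ : Ω → Measure (EuclideanSpace ℝ (Fin n)))
    (hξ : IsPointProcess ξ) (hsimple : IsSimplePointProcess P ξ)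
    (hstat : IsStationaryMeasure P ξ) (herg : IsErgodicMeasure P ξ) (hmom : HasAllFiniteMoments P ξ) :
    ∃ 𝔭 : Set (EuclideanSpace ℝ (Fin n)) → Measure BirthDeathPlane,
      IsPersistenceDiagramExpectationMeasure F P ξ 𝔭 ∧
      ∀ A, MeasurableSet A → IsBounded A → ∀ B, MeasurableSet B → IsBounded B →
        𝔭 A B < ∞ := by
  have happly : ∀ A, MeasurableSet A → IsBounded A → ∀ B, MeasurableSet B →
      P.bind (fun ω => persistenceDiagramMeasure F (ξ ω) A) B =
        ∫⁻ ω, persistenceDiagramMeasure F (ξ ω) A B ∂P := fun A hA hb B hB =>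
    Measure.bind_apply hB (hξ.measurable_persistenceDiagramMeasure F hA hb).aemeasurable
  -- The whole half plane already has finite expected mass, which gives both the Radon property and
  -- finiteness on bounded sets.
  have hfin : ∀ A, MeasurableSet A → IsBounded A → ∀ B,
      P.bind (fun ω => persistenceDiagramMeasure F (ξ ω) A) B < ∞ := fun A hA hb B =>
    (measure_mono (Set.subset_univ B)).trans_lt <| by
      rw [happly A hA hb _ .univ]
      exact lintegral_persistenceDiagramMeasure_univ_lt_top F P hξ hmom hA hb
  exact ⟨fun A => P.bind fun ω => persistenceDiagramMeasure F (ξ ω) A,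
    ⟨fun A hA hb => hξ.isPointProcess_persistenceDiagramMeasure F hA hb, happly,
      fun A hA hb B _ _ => hfin A hA hb B⟩,
    fun A hA hb B _ _ => hfin A hA hb B⟩
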